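/- Let $d,d'$ be positive integers. Write $\mathcal D_d$ for the set of $d\times d$ density matrices (positive semidefinite complex matrices with trace one). A set $\mathcal F\subseteq\mathcal D_d$ is called affine if every real linear combination of elements of $\mathcal F$ that is a density matrix belongs to $\mathcal F$. Its dual is $\mathcal F^\star=\{\omega\in\mathcal D_d : \mathrm{Tr}[\omega\sigma]=\mathrm{Tr}[\omega\sigma']\ \ \forall \sigma,\sigma'\in\mathcal F\}$, and, for non-empty $\mathcal F$ and $\omega\in\mathcal F^\star$, $g(\omega)$ denotes the common value of $\mathrm{Tr}[\omega\sigma]$, $\sigma\in\mathcal F$. For a bipartite positive semidefinite matrix $\Omega^{AB}\neq 0$, the conditional min-entropy is defined by $2^{-H_{\min}(A|B)_\Omega}=\inf\{\mathrm{Tr}\,\tau : \tau\ge 0,\ I_A\otimes\tau\ge\Omega^{AB}\}$. Let $\mathcal F_{\rm in}\subseteq\mathcal D_d$ and $\mathcal F_{\rm out}\subseteq\mathcal D_{d'}$ be non-empty affine sets. A resource non-generating (RNG) operation is a completely positive trace preserving linear map $\mathcal E$ from $d\times d$ to $d'\times d'$ matrices with $\mathcal E(\mathcal F_{\rm in})\subseteq\mathcal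 F_{\rm out}$. Let $\rho\in\mathcal D_d$, $\rho'\in\mathcal D_{d'}$, let $n=\dim\mathrm{span}_{\mathbb R}\mathcal F_{\rm in}$, and let $\sigma_1,\dots,\sigma_n\in\mathcal F_{\rm in}$ satisfy $\mathrm{span}_{\mathbb R}\{\sigma_1,\dots,\sigma_n\}=\mathrm{span}_{\mathbb R}\mathcal F_{\rm in}$. For $\eta\in\mathcal D_{d'}$, $\omega_1,\dots,\omega_n\in\mathcal F_{\rm out}^\star$, density matrices $\tau_1,\dots,\tau_n$ and a density matrix $\kappa$ (the $\tau_\ell$ and $\kappa$ all of size $d$, or all of size $d'$), put $\Theta=\frac1n\sum_{\ell=1}^n\omega_\ell^T\otimes\tau_\ell$ and $$\Omega_{\eta,\Theta}(\kappa)=\frac{1}{n+1}\bigl(\eta^T\otimes\kappa+n\Theta\bigr),$$ where $A$ is the first tensor factor and $B$ the second. For $\boldsymbol\omega=(\eta,\omega_1,\dots,\omega_n)$ let $\Omega_{\boldsymbol\omega}(\rho)=\Omega_{\eta,\Theta}(\rho)$ with $\tau_\ell=\sigma_\ell$ the fixed matrices above. For $t\in g(\mathcal F_{\rm out}^\star)$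 let $\mathcal S_t^{\rm in}$ (respectively $\mathcal S_t^{\rm out}$) be the set of all $\Theta=\frac1n\sum_\ell\omega_\ell^T\otimes\tau_\ell$ with $\omega_\ell\in\mathcal F_{\rm out}^\star$, $g\bigl(\frac1n\sum_\ell\omega_\ell\bigr)=t$ and all $\tau_\ell\in\mathcal F_{\rm in}$ (respectively all $\tau_\ell\in\mathcal F_{\rm out}$). Define $$R_{\eta,t}(\rho)=\inf_{\Theta\in\mathcal S_t^{\rm in}}2^{-H_{\min}(A|B)_{\Omega_{\eta,\Theta}(\rho)}},\qquad R_{\eta,t}(\rho')=\inf_{\Theta\in\mathcal S_t^{\rm out}}2^{-H_{\min}(A|B)_{\Omega_{\eta,\Theta}(\rho')}},$$ and, for fixed $\boldsymbol\omega=(\eta,\omega_1,\dots,\omega_n)$, let $f_{\boldsymbol\omega}(\rho)$ (respectively $f_{\boldsymbol\omega}(\rho')$) be the infimum of $2^{-H_{\min}(A|B)_{\Omega_{\eta,\Theta}(\rho)}}$ (respectively with $\rho'$ in place of $\rho$) over all $\Theta=\frac1n\sum_\ell\omega_\ell^T\otimes\tau_\ell$ with $\tau_1,\dots,\tau_n\in\mathcal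 F_{\rm in}$ (respectively $\in\mathcal F_{\rm out}$). By compactness, all these infima are minima. Then the following are equivalent: 1. There exists an RNG operation $\mathcal E$ with $\rho'=\mathcal E(\rho)$. 2. For all $\eta\in\mathcal D_{d'}$ and $\omega_1,\dots,\omega_n\in\mathcal F_{\rm out}^\star$, with $\boldsymbol\omega=(\eta,\omega_1,\dots,\omega_n)$ and $\omega=\frac1n\sum_{j=1}^n\omega_j$, $$2^{-H_{\min}(A|B)_{\Omega_{\boldsymbol\omega}(\rho)}}\ \ge\ \frac{\mathrm{Tr}[\eta\rho']+n\,g(\omega)}{n+1}.$$ 3. For all $\eta\in\mathcal D_{d'}$ and all $t\in g(\mathcal F_{\rm out}^\star)$, $R_{\eta,t}(\rho)\ge R_{\eta,t}(\rho')$. 4. For all $\eta\in\mathcal D_{d'}$ and all $\omega_1,\dots,\omega_n\in\mathcal F_{\rm out}^\star$, with $\boldsymbol\omega=(\eta,\omega_1,\dots,\omega_n)$, $f_{\boldsymbol\omega}(\rho)\ge f_{\boldsymbol\omega}(\rho')$. -/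

import Mathlib

open scoped Kronecker ComplexOrder

namespace AffineResource

/-- The set of density matrices of size `d`: positive semidefinite with trace one. -/
def densityMatrices (d : ℕ) : Set (Matrix (Fin d) (Fin d) ℂ) :=
  {ρ | ρ.PosSemidef ∧ ρ.trace = 1}

/-- A set of density matrices is affine if every real linear combination of its elements that is
a density matrix is again an element.  (The coefficients then sum to one, by taking traces.) -/
def IsAffine {d : ℕ} (F : Set (Matrix (Fin d) (Fin d) ℂ)) : Prop :=
  F ⊆ densityMatrices d ∧
    ∀ (k : ℕ) (t : Fin k → ℝ) (σ : Fin k → Matrix (Fin d) (Fin d) ℂ),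
      (∀ i, σ i ∈ F) → ∑ i, t i • σ i ∈ densityMatrices d → ∑ i, t i • σ i ∈ F

/-- A linear map between matrix algebras is completely positive if, for every `k`, applying it to
each block of a positive semidefinite `k × k` block matrix gives a positive semidefinite matrix. -/
def IsCompletelyPositive {d d' : ℕ}
    (E : Matrix (Fin d) (Fin d) ℂ →ₗ[ℂ] Matrix (Fin d') (Fin d') ℂ) : Prop :=
  ∀ (k : ℕ) (X : Matrix (Fin k × Fin d) (Fin k × Fin d) ℂ), X.PosSemidef →
    (Matrix.of fun (p q : Fin k × Fin d') =>
      E (Matrix.of fun a b => X (p.1, a) (q.1, b)) p.2 q.2).PosSemidef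

/-- Quantum channels: completely positive and trace preserving linear maps. -/
def IsChannel {d d' : ℕ}
    (E : Matrix (Fin d) (Fin d) ℂ →ₗ[ℂ] Matrix (Fin d') (Fin d') ℂ) : Prop :=
  IsCompletelyPositive E ∧ ∀ X, (E X).trace = X.trace

/-- The resource non-generating operations: channels that map free states to free states. -/
def rngOperations {d d' : ℕ} (Finp : Set (Matrix (Fin d) (Fin d) ℂ))
    (Fout : Set (Matrix (Fin d') (Fin d') ℂ)) :
    Set (Matrix (Fin d) (Fin d) ℂ →ₗ[ℂ] Matrix (Fin d') (Fin d') ℂ) :=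
  {E | IsChannel E ∧ ∀ σ ∈ Finp, E σ ∈ Fout}

/-- The dual set of a set of states. -/
def dual {d : ℕ} (F : Set (Matrix (Fin d) (Fin d) ℂ)) : Set (Matrix (Fin d) (Fin d) ℂ) :=
  {ω | ω ∈ densityMatrices d ∧ ∀ σ ∈ F, ∀ σ' ∈ F, (ω * σ).trace = (ω * σ').trace}

open Classical in
/-- The function `g(ω) = Tr[ωσ]`, where `σ` is any state in `F`; it does not depend on `σ` when `ω`
lies in the dual of `F`, see `overlap_eq`. -/
noncomputable def overlap {d : ℕ} (F : Set (Matrix (Fin d) (Fin d) ℂ))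
    (ω : Matrix (Fin d) (Fin d) ℂ) : ℝ :=
  if h : F.Nonempty then (ω * h.some).trace.re else 0

theorem overlap_eq {d : ℕ} {F : Set (Matrix (Fin d) (Fin d) ℂ)} {ω σ : Matrix (Fin d) (Fin d) ℂ}
    (hω : ω ∈ dual F) (hσ : σ ∈ F) : overlap F ω = (ω * σ).trace.re := by
  have h : F.Nonempty := ⟨σ, hσ⟩
  rw [overlap, dif_pos h, hω.2 _ h.some_mem _ hσ]

/-- The conditional min-entropy `H_min(A|B)` of a bipartite matrix, with `A` the first factor:
`2 ^ (-H_min) = inf {Tr τ | τ ≥ 0, I ⊗ τ ≥ Ω}`. -/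
noncomputable def condMinEntropy {a b : ℕ}
    (Ω : Matrix (Fin a × Fin b) (Fin a × Fin b) ℂ) : ℝ :=
  -Real.logb 2 (sInf {x : ℝ | ∃ τ : Matrix (Fin b) (Fin b) ℂ, τ.PosSemidef ∧
    ((1 : Matrix (Fin a) (Fin a) ℂ) ⊗ₖ τ - Ω).PosSemidef ∧ x = τ.trace.re})

/-- The average `(ω₁ + ⋯ + ωₙ) / n`. -/
noncomputable def average {a n : ℕ} (ω : Fin n → Matrix (Fin a) (Fin a) ℂ) :
    Matrix (Fin a) (Fin a) ℂ :=
  (n : ℂ)⁻¹ • ∑ l, ω l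

/-- The bipartite state `Θ = (1/n) ∑ ωₗᵀ ⊗ σₗ`. -/
noncomputable def Theta {a b n : ℕ} (ω : Fin n → Matrix (Fin a) (Fin a) ℂ)
    (σ : Fin n → Matrix (Fin b) (Fin b) ℂ) : Matrix (Fin a × Fin b) (Fin a × Fin b) ℂ :=
  (n : ℂ)⁻¹ • ∑ l, (ω l).transpose ⊗ₖ σ l

/-- The bipartite state `Ω = (ηᵀ ⊗ ρ + n Θ) / (n + 1)`. -/
noncomputable def Omega {a b : ℕ} (n : ℕ) (η : Matrix (Fin a) (Fin a) ℂ)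
    (Θ : Matrix (Fin a × Fin b) (Fin a × Fin b) ℂ) (ρ : Matrix (Fin b) (Fin b) ℂ) :
    Matrix (Fin a × Fin b) (Fin a × Fin b) ℂ :=
  ((n : ℂ) + 1)⁻¹ • (η.transpose ⊗ₖ ρ + (n : ℂ) • Θ)

/-- The set of all states `Θ = (1/n) ∑ ωₗᵀ ⊗ σₗ` with `ωₗ` in the dual of `Fout`, with `σₗ ∈ F`,
and such that `g` takes the value `t` at the average of the `ωₗ`.  It is used for `F = F_in` and for
`F = F_out`. -/
def thetaSet {a b : ℕ} (Fout : Set (Matrix (Fin a) (Fin a) ℂ))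
    (F : Set (Matrix (Fin b) (Fin b) ℂ)) (n : ℕ) (t : ℝ) :
    Set (Matrix (Fin a × Fin b) (Fin a × Fin b) ℂ) :=
  {Θ | ∃ (ω : Fin n → Matrix (Fin a) (Fin a) ℂ) (σ : Fin n → Matrix (Fin b) (Fin b) ℂ),
    (∀ l, ω l ∈ dual Fout) ∧ (∀ l, σ l ∈ F) ∧ overlap Fout (average ω) = t ∧ Θ = Theta ω σ}

/-- The function `R_{η,t}`: the least value of `2 ^ (-H_min(A|B))` at `Ω_{η,Θ}(ρ)` over all
`Θ ∈ thetaSet Fout F n t`. -/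
noncomputable def R {a b : ℕ} (Fout : Set (Matrix (Fin a) (Fin a) ℂ))
    (F : Set (Matrix (Fin b) (Fin b) ℂ)) (n : ℕ) (η : Matrix (Fin a) (Fin a) ℂ) (t : ℝ)
    (ρ : Matrix (Fin b) (Fin b) ℂ) : ℝ :=
  sInf ((fun Θ => (2 : ℝ) ^ (-condMinEntropy (Omega n η Θ ρ))) '' thetaSet Fout F n t)

/-- The function `f_ω` with `ω = (η, ω₁, …, ωₙ)`: the least value of `2 ^ (-H_min(A|B))` at
`Ω_{η,Θ}(ρ)` over all `Θ = (1/n) ∑ ωₗᵀ ⊗ σₗ` with `σₗ ∈ F`. -/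
noncomputable def f {a b n : ℕ} (F : Set (Matrix (Fin b) (Fin b) ℂ))
    (η : Matrix (Fin a) (Fin a) ℂ) (ω : Fin n → Matrix (Fin a) (Fin a) ℂ)
    (ρ : Matrix (Fin b) (Fin b) ℂ) : ℝ :=
  sInf ((fun σ : Fin n → Matrix (Fin b) (Fin b) ℂ =>
    (2 : ℝ) ^ (-condMinEntropy (Omega n η (Theta ω σ) ρ))) '' {σ | ∀ l, σ l ∈ F})

end AffineResource

/-!
Write `Φ_E` for the functional on bipartite matrices with `Φ_E (Mᵀ ⊗ Y) = Tr[M E(Y)]`.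

*A free channel implies the monotonicity statements.* If `I ⊗ τ ≥ Ω`, then applying `id ⊗ E` gives
`I ⊗ E(τ) ≥ (id ⊗ E)(Ω)` with `Tr E(τ) = Tr τ`, and `id ⊗ E` maps a state `Ω` built from `ρ` and
free input states to one built from `E(ρ)` and free output states
(`IsChannel.two_rpow_neg_condMinEntropy_le`).

*Monotonicity implies the entropic inequalities.* On the output side, testing `I ⊗ τ ≥ Ω` against
the maximally entangled vector shows that every value in the infimum is at least
`(Tr[η ρ'] + n g(ω)) / (n + 1)` (`le_two_rpow_neg_condMinEntropy`).

*The entropic inequalities imply a free channel.* Neither strong duality for the semidefinite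
program nor a minimax theorem is needed: one application of the M. Riesz extension theorem yields
the channel. On the real space spanned by the matrices `I ⊗ τ`, `ηᵀ ⊗ ρ` and `ωᵀ ⊗ σₗ`, with `ω` in
the linear space `realDual` generalizing the dual set, prescribe the real parts of `Tr τ`, `Tr[η
ρ']` and `Tr[ω s]` as the values of a functional, where `s` is a fixed free output state. The
entropic inequalities, after shifting and rescaling `η` and the `ωₗ` to density matrices, say that
this functional is nonnegative on matrices with positive semidefinite Hermitian part
(`nonneg_of_forall_le_condMinEntropy`); in particular it is well defined. The complexification of a
positive extension to all matrices is `Φ_E` for a channel `E` (`isChannel_mapOfFunctional`), the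
prescribed values give `E(ρ) = ρ'`, and each `E(σₗ)` is indistinguishable by the dual set from the
free states, hence free (`IsAffine.mem_of_forall_realDual`). Since the `σₗ` span, `E` maps every
free state to a free state.
-/

namespace AffineResource

open Matrix

/-! ### Positive semidefinite matrices -/

open scoped MatrixOrder Matrix.Norms.L2Operator in
theorem exists_forall_ge_posSemidef_smul_one_sub {ι : Type*} [Fintype ι] [DecidableEq ι]
    {H : Matrix ι ι ℂ} (hH : H.IsHermitian) :
    ∃ C : ℝ, ∀ N : ℝ, C ≤ N → ((N : ℂ) • (1 : Matrix ι ι ℂ) - H).PosSemidef := by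
  refine ⟨‖H‖, fun N hN => ?_⟩
  have h1 : (algebraMap ℝ (Matrix ι ι ℂ) ‖H‖ - H).PosSemidef :=
    Matrix.le_iff.mp (IsSelfAdjoint.le_algebraMap_norm_self (ha := hH))
  have h2 : (((N - ‖H‖ : ℝ) : ℂ) • (1 : Matrix ι ι ℂ)).PosSemidef :=
    PosSemidef.one.smul (by exact_mod_cast sub_nonneg.2 hN)
  convert h1.add h2 using 1
  rw [Algebra.algebraMap_eq_smul_one, Complex.ofReal_sub, sub_smul, Complex.coe_smul,
    Complex.coe_smul]
  abel

theorem posSemidef_of_one_kronecker {a b : ℕ} (ha : 0 < a) {τ : Matrix (Fin b) (Fin b) ℂ}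
    (h : ((1 : Matrix (Fin a) (Fin a) ℂ) ⊗ₖ τ).PosSemidef) : τ.PosSemidef := by
  convert h.submatrix (fun j : Fin b => ((⟨0, ha⟩ : Fin a), j)) using 1
  ext i j
  simp

theorem trace_re_le_of_le_one_kronecker {a b : ℕ} {τ : Matrix (Fin b) (Fin b) ℂ}
    {Ω : Matrix (Fin a × Fin b) (Fin a × Fin b) ℂ}
    (h : ((1 : Matrix (Fin a) (Fin a) ℂ) ⊗ₖ τ - Ω).PosSemidef) :
    Ω.trace.re ≤ a * τ.trace.re := by
  have h1 := (Complex.nonneg_iff.mp h.trace_nonneg).1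
  rw [trace_sub, trace_kronecker, trace_one, Fintype.card_fin, Complex.sub_re,
    ← nsmul_eq_mul, Complex.re_nsmul, nsmul_eq_mul] at h1
  linarith

theorem trace_re_nonneg_of_posSemidef {ι : Type*} [Fintype ι] {M : Matrix ι ι ℂ}
    (h : M.PosSemidef) : 0 ≤ M.trace.re :=
  (Complex.nonneg_iff.mp h.trace_nonneg).1

/-! ### The conditional min-entropy -/

/-- The traces of the matrices `τ ≥ 0` with `I ⊗ τ ≥ Ω`, whose infimum is `2 ^ (-H_min(A|B))`. -/
def feasibleTraces {a b : ℕ} (Ω : Matrix (Fin a × Fin b) (Fin a × Fin b) ℂ) : Set ℝ :=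
  {x : ℝ | ∃ τ : Matrix (Fin b) (Fin b) ℂ, τ.PosSemidef ∧
    ((1 : Matrix (Fin a) (Fin a) ℂ) ⊗ₖ τ - Ω).PosSemidef ∧ x = τ.trace.re}

theorem feasibleTraces_nonempty {a b : ℕ} {Ω : Matrix (Fin a × Fin b) (Fin a × Fin b) ℂ}
    (hΩ : Ω.IsHermitian) : (feasibleTraces Ω).Nonempty := by
  obtain ⟨C, hC⟩ := exists_forall_ge_posSemidef_smul_one_sub hΩ
  refine ⟨_, ((max C 0 : ℝ) : ℂ) • 1, PosSemidef.one.smul ?_, ?_, rfl⟩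
  · exact_mod_cast le_max_right C 0
  · rw [kronecker_smul, one_kronecker_one]
    exact hC _ (le_max_left _ _)

theorem bddBelow_feasibleTraces {a b : ℕ} (Ω : Matrix (Fin a × Fin b) (Fin a × Fin b) ℂ) :
    BddBelow (feasibleTraces Ω) :=
  ⟨0, by rintro _ ⟨τ, hτ, -, rfl⟩; exact trace_re_nonneg_of_posSemidef hτ⟩

/-- The trace of `Ω` is required to be positive because `Real.logb 2 0 = 0`, which would make
`2 ^ (-H_min)` equal to `1` where the infimum is `0`. -/
theorem two_rpow_neg_condMinEntropy {a b : ℕ} {Ω : Matrix (Fin a × Fin b) (Fin a × Fin b) ℂ}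
    (hΩ : Ω.IsHermitian) (htr : 0 < Ω.trace.re) :
    (2 : ℝ) ^ (-condMinEntropy Ω) = sInf (feasibleTraces Ω) := by
  rw [condMinEntropy, neg_neg]
  refine Real.rpow_logb two_pos (by norm_num) ?_
  have ha : (0 : ℝ) < a := by
    rcases Nat.eq_zero_or_pos a with rfl | h
    · simp [trace] at htr
    · exact_mod_cast h
  refine (div_pos htr ha).trans_le (le_csInf (feasibleTraces_nonempty hΩ) ?_)
  rintro _ ⟨τ, -, hτ, rfl⟩
  rw [div_le_iff₀' ha]
  exact trace_re_le_of_le_one_kronecker hτ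

/-! ### Maps acting on the second tensor factor -/

/-- The map `id ⊗ E`, acting on each block of a `k × k` block matrix. -/
def blockMap {d d' : ℕ} (k : ℕ) (E : Matrix (Fin d) (Fin d) ℂ →ₗ[ℂ] Matrix (Fin d') (Fin d') ℂ) :
    Matrix (Fin k × Fin d) (Fin k × Fin d) ℂ →ₗ[ℂ]
      Matrix (Fin k × Fin d') (Fin k × Fin d') ℂ where
  toFun X := Matrix.of fun p q => E (Matrix.of fun a b => X (p.1, a) (q.1, b)) p.2 q.2
  map_add' X Y := by
    ext p q
    exact congrFun₂ (map_add E (Matrix.of fun a b => X (p.1, a) (q.1, b))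
      (Matrix.of fun a b => Y (p.1, a) (q.1, b))) p.2 q.2
  map_smul' c X := by
    ext p q
    exact congrFun₂ (map_smul E c (Matrix.of fun a b => X (p.1, a) (q.1, b))) p.2 q.2

theorem blockMap_kronecker {d d' k : ℕ}
    (E : Matrix (Fin d) (Fin d) ℂ →ₗ[ℂ] Matrix (Fin d') (Fin d') ℂ)
    (M : Matrix (Fin k) (Fin k) ℂ) (Y : Matrix (Fin d) (Fin d) ℂ) :
    blockMap k E (M ⊗ₖ Y) = M ⊗ₖ E Y := by
  ext p q
  exact congrFun₂ (map_smul E (M p.1 q.1) Y) p.2 q.2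

theorem blockMap_Omega_Theta {d d' a n : ℕ}
    (E : Matrix (Fin d) (Fin d) ℂ →ₗ[ℂ] Matrix (Fin d') (Fin d') ℂ)
    (η : Matrix (Fin a) (Fin a) ℂ) (ω : Fin n → Matrix (Fin a) (Fin a) ℂ)
    (σ : Fin n → Matrix (Fin d) (Fin d) ℂ) (ρ : Matrix (Fin d) (Fin d) ℂ) :
    blockMap a E (Omega n η (Theta ω σ) ρ) = Omega n η (Theta ω fun l => E (σ l)) (E ρ) := by
  simp only [Omega, Theta, map_smul, map_add, map_sum, blockMap_kronecker]

theorem IsCompletelyPositive.posSemidef_apply {d d' : ℕ}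
    {E : Matrix (Fin d) (Fin d) ℂ →ₗ[ℂ] Matrix (Fin d') (Fin d') ℂ}
    (hE : IsCompletelyPositive E) {X : Matrix (Fin d) (Fin d) ℂ} (hX : X.PosSemidef) :
    (E X).PosSemidef := by
  have h : (blockMap 1 E ((1 : Matrix (Fin 1) (Fin 1) ℂ) ⊗ₖ X)).PosSemidef :=
    hE 1 _ (PosSemidef.one.kronecker hX)
  rw [blockMap_kronecker] at h
  exact posSemidef_of_one_kronecker one_pos h

theorem IsChannel.apply_mem {d d' : ℕ}
    {E : Matrix (Fin d) (Fin d) ℂ →ₗ[ℂ] Matrix (Fin d') (Fin d') ℂ}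
    (hE : IsChannel E) {X : Matrix (Fin d) (Fin d) ℂ} (hX : X ∈ densityMatrices d) :
    E X ∈ densityMatrices d' :=
  ⟨hE.1.posSemidef_apply hX.1, (hE.2 X).trans hX.2⟩

/-! ### The states `Ω` -/

theorem natCast_smul_Theta {a b n : ℕ} (hn : 0 < n) (ω : Fin n → Matrix (Fin a) (Fin a) ℂ)
    (σ : Fin n → Matrix (Fin b) (Fin b) ℂ) :
    (n : ℂ) • Theta ω σ = ∑ l, (ω l).transpose ⊗ₖ σ l := by
  rw [Theta, smul_smul, mul_inv_cancel₀ (by exact_mod_cast hn.ne'), one_smul]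

theorem posSemidef_Omega_Theta {a b n : ℕ} {η : Matrix (Fin a) (Fin a) ℂ}
    (hη : η ∈ densityMatrices a) {ω : Fin n → Matrix (Fin a) (Fin a) ℂ}
    (hω : ∀ l, ω l ∈ densityMatrices a) {σ : Fin n → Matrix (Fin b) (Fin b) ℂ}
    (hσ : ∀ l, σ l ∈ densityMatrices b) {ρ : Matrix (Fin b) (Fin b) ℂ}
    (hρ : ρ ∈ densityMatrices b) : (Omega n η (Theta ω σ) ρ).PosSemidef := by
  have hn : (0 : ℂ) ≤ n := Nat.cast_nonneg n
  refine ((hη.1.transpose.kronecker hρ.1).add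
    (((posSemidef_sum _ fun l _ => (hω l).1.transpose.kronecker (hσ l).1).smul ?_).smul hn)).smul ?_
  · exact inv_nonneg.2 hn
  · exact inv_nonneg.2 (add_nonneg hn zero_le_one)

theorem trace_Omega_Theta {a b n : ℕ} (hn : 0 < n) {η : Matrix (Fin a) (Fin a) ℂ}
    (hη : η ∈ densityMatrices a) {ω : Fin n → Matrix (Fin a) (Fin a) ℂ}
    (hω : ∀ l, ω l ∈ densityMatrices a) {σ : Fin n → Matrix (Fin b) (Fin b) ℂ}
    (hσ : ∀ l, σ l ∈ densityMatrices b) {ρ : Matrix (Fin b) (Fin b) ℂ}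
    (hρ : ρ ∈ densityMatrices b) : (Omega n η (Theta ω σ) ρ).trace = 1 := by
  have h : (n : ℂ) + 1 ≠ 0 := by exact_mod_cast n.succ_ne_zero
  rw [Omega, natCast_smul_Theta hn]
  simp only [trace_smul, trace_add, trace_sum, trace_kronecker, trace_transpose, hη.2, hρ.2,
    (hω _).2, (hσ _).2, mul_one, Finset.sum_const, Finset.card_univ, Fintype.card_fin, smul_eq_mul,
    nsmul_eq_mul]
  rw [add_comm 1, inv_mul_cancel₀ h]

theorem two_rpow_neg_condMinEntropy_Omega_Theta {a b n : ℕ} (hn : 0 < n)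
    {η : Matrix (Fin a) (Fin a) ℂ}
    (hη : η ∈ densityMatrices a) {ω : Fin n → Matrix (Fin a) (Fin a) ℂ}
    (hω : ∀ l, ω l ∈ densityMatrices a) {σ : Fin n → Matrix (Fin b) (Fin b) ℂ}
    (hσ : ∀ l, σ l ∈ densityMatrices b) {ρ : Matrix (Fin b) (Fin b) ℂ}
    (hρ : ρ ∈ densityMatrices b) :
    (2 : ℝ) ^ (-condMinEntropy (Omega n η (Theta ω σ) ρ)) =
      sInf (feasibleTraces (Omega n η (Theta ω σ) ρ)) :=
  two_rpow_neg_condMinEntropy (posSemidef_Omega_Theta hη hω hσ hρ).1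
    (by rw [trace_Omega_Theta hn hη hω hσ hρ]; exact one_pos)

/-- Data processing: a channel on the second factor cannot increase `2 ^ (-H_min(A|B))`. -/
theorem IsChannel.two_rpow_neg_condMinEntropy_le {d d' a n : ℕ}
    {E : Matrix (Fin d) (Fin d) ℂ →ₗ[ℂ] Matrix (Fin d') (Fin d') ℂ} (hE : IsChannel E)
    (hn : 0 < n) {η : Matrix (Fin a) (Fin a) ℂ}
    (hη : η ∈ densityMatrices a) {ω : Fin n → Matrix (Fin a) (Fin a) ℂ}
    (hω : ∀ l, ω l ∈ densityMatrices a) {σ : Fin n → Matrix (Fin d) (Fin d) ℂ}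
    (hσ : ∀ l, σ l ∈ densityMatrices d) {ρ : Matrix (Fin d) (Fin d) ℂ}
    (hρ : ρ ∈ densityMatrices d) :
    (2 : ℝ) ^ (-condMinEntropy (Omega n η (Theta ω fun l => E (σ l)) (E ρ))) ≤
      (2 : ℝ) ^ (-condMinEntropy (Omega n η (Theta ω σ) ρ)) := by
  rw [two_rpow_neg_condMinEntropy_Omega_Theta hn hη hω hσ hρ,
    two_rpow_neg_condMinEntropy_Omega_Theta hn hη hω (fun l => hE.apply_mem (hσ l))
      (hE.apply_mem hρ)]
  refine le_csInf (feasibleTraces_nonempty (posSemidef_Omega_Theta hη hω hσ hρ).1) ?_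
  rintro _ ⟨τ, hτ, hle, rfl⟩
  refine csInf_le (bddBelow_feasibleTraces _) ⟨E τ, hE.1.posSemidef_apply hτ, ?_, by rw [hE.2]⟩
  have h : (blockMap a E
      ((1 : Matrix (Fin a) (Fin a) ℂ) ⊗ₖ τ - Omega n η (Theta ω σ) ρ)).PosSemidef :=
    hE.1 a _ hle
  rwa [map_sub, blockMap_kronecker, blockMap_Omega_Theta] at h

/-! ### The pairing with the maximally entangled vector -/

/-- The unnormalized maximally entangled vector `∑ᵢ eᵢ ⊗ eᵢ`. -/
def maxEntangled (d : ℕ) : Fin d × Fin d → ℂ := fun p => if p.1 = p.2 then 1 else 0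

theorem maxEntangled_dotProduct_mulVec {d : ℕ} (Z : Matrix (Fin d × Fin d) (Fin d × Fin d) ℂ) :
    star (maxEntangled d) ⬝ᵥ (Z *ᵥ maxEntangled d) = ∑ i, ∑ j, Z (i, i) (j, j) := by
  simp [dotProduct, mulVec, maxEntangled, Fintype.sum_prod_type]

theorem maxEntangled_kronecker {d : ℕ} (M Y : Matrix (Fin d) (Fin d) ℂ) :
    star (maxEntangled d) ⬝ᵥ ((M.transpose ⊗ₖ Y) *ᵥ maxEntangled d) = (M * Y).trace := by
  rw [maxEntangled_dotProduct_mulVec, Finset.sum_comm]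
  simp [trace, mul_apply]

/-- The lower bound on `2 ^ (-H_min(A|B))` obtained by testing `I ⊗ τ ≥ Ω` against the maximally
entangled vector. -/
theorem le_two_rpow_neg_condMinEntropy {d n : ℕ} (hn : 0 < n) {η : Matrix (Fin d) (Fin d) ℂ}
    (hη : η ∈ densityMatrices d) {ω : Fin n → Matrix (Fin d) (Fin d) ℂ}
    (hω : ∀ l, ω l ∈ densityMatrices d) {σ : Fin n → Matrix (Fin d) (Fin d) ℂ}
    (hσ : ∀ l, σ l ∈ densityMatrices d) {ρ : Matrix (Fin d) (Fin d) ℂ}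
    (hρ : ρ ∈ densityMatrices d) :
    ((η * ρ).trace.re + ∑ l, (ω l * σ l).trace.re) / (n + 1) ≤
      (2 : ℝ) ^ (-condMinEntropy (Omega n η (Theta ω σ) ρ)) := by
  rw [two_rpow_neg_condMinEntropy_Omega_Theta hn hη hω hσ hρ]
  refine le_csInf (feasibleTraces_nonempty (posSemidef_Omega_Theta hη hω hσ hρ).1) ?_
  rintro _ ⟨τ, -, hle, rfl⟩
  have h := (Complex.nonneg_iff.mp (hle.dotProduct_mulVec_nonneg (maxEntangled d))).1
  rw [sub_mulVec, dotProduct_sub, ← transpose_one, maxEntangled_kronecker, one_mul, Omega,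
    natCast_smul_Theta hn, smul_mulVec, dotProduct_smul, add_mulVec, dotProduct_add,
    maxEntangled_kronecker, sum_mulVec, dotProduct_sum] at h
  simp only [maxEntangled_kronecker] at h
  rw [show ((n : ℂ) + 1)⁻¹ = (((n : ℝ) + 1)⁻¹ : ℝ) by push_cast; rfl, smul_eq_mul, Complex.sub_re,
    Complex.re_ofReal_mul, Complex.add_re, Complex.re_sum] at h
  rw [div_eq_inv_mul]
  linarith

/-! ### Channels from positive functionals -/

/-- A form of the M. Riesz extension theorem in which the functional to be extended is given on the
range of a linear map `A` by its pullback `ψ` along `A`. The positivity hypothesis also guarantees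
that `ψ` descends to the range of `A`. -/
theorem exists_nonneg_extension {X Y : Type*} [AddCommGroup X] [Module ℝ X] [AddCommGroup Y]
    [Module ℝ Y] (s : PointedCone ℝ X) (A : Y →ₗ[ℝ] X) (ψ : Y →ₗ[ℝ] ℝ)
    (hpos : ∀ y, A y ∈ s → 0 ≤ ψ y) (hdense : ∀ x, ∃ y, A y + x ∈ s) :
    ∃ φ : X →ₗ[ℝ] ℝ, (∀ y, φ (A y) = ψ y) ∧ ∀ x ∈ s, 0 ≤ φ x := by
  have hker : ψ ∈ (LinearMap.ker A).dualAnnihilator := by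
    rw [Submodule.mem_dualAnnihilator]
    intro y hy
    rw [LinearMap.mem_ker] at hy
    refine le_antisymm ?_ (hpos y (hy ▸ s.zero_mem))
    have h := hpos (-y) (by rw [map_neg, hy, neg_zero]; exact s.zero_mem)
    rwa [map_neg, neg_nonneg] at h
  rw [← LinearMap.range_dualMap_eq_dualAnnihilator_ker] at hker
  obtain ⟨φ₀, rfl⟩ := hker
  obtain ⟨φ, hφ, hφs⟩ := riesz_extension s
    ⟨LinearMap.range A, φ₀.comp (LinearMap.range A).subtype⟩
    (by rintro ⟨_, y, rfl⟩ hy; exact hpos y hy)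
    (fun x => let ⟨y, hy⟩ := hdense x; ⟨⟨A y, y, rfl⟩, hy⟩)
  exact ⟨φ, fun y => hφ ⟨A y, y, rfl⟩, hφs⟩

/-- The real cone of complex matrices with positive semidefinite Hermitian part. Unlike the cone of
positive semidefinite matrices, it has the identity as an order unit in the space of all matrices. -/
def hermitianPartCone (ι : Type*) : PointedCone ℝ (Matrix ι ι ℂ) where
  carrier := {X | (X + Xᴴ).PosSemidef}
  zero_mem' := by simpa using PosSemidef.zero
  add_mem' {X Y} hX hY := by
    simp only [Set.mem_ofPred_eq] at hX hY ⊢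
    convert hX.add hY using 1
    rw [conjTranspose_add]
    abel
  smul_mem' c X hX := by
    simp only [Set.mem_ofPred_eq] at hX ⊢
    convert hX.smul c.2 using 1
    rw [smul_add]
    congr 1
    exact (conjTranspose_smul (c : ℝ) X).trans (congrArg (· • Xᴴ) (star_trivial (c : ℝ)))

theorem mem_hermitianPartCone {ι : Type*} {X : Matrix ι ι ℂ} :
    X ∈ hermitianPartCone ι ↔ (X + Xᴴ).PosSemidef := Iff.rfl

/-- The complexification of a real functional that is nonnegative on `hermitianPartCone` is a
positive functional: it is real on Hermitian matrices because the cone contains the whole space of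
anti-Hermitian matrices. -/
theorem extendRCLike_nonneg {ι : Type*} {φ : Matrix ι ι ℂ →ₗ[ℝ] ℝ}
    (hφ : ∀ X ∈ hermitianPartCone ι, 0 ≤ φ X) {X : Matrix ι ι ℂ} (hX : X.PosSemidef) :
    0 ≤ Module.Dual.extendRCLike (𝕜 := ℂ) φ X := by
  have hanti : ∀ K : Matrix ι ι ℂ, Kᴴ = -K → φ K = 0 := by
    intro K hK
    have h1 := hφ K (by simpa [mem_hermitianPartCone, hK] using PosSemidef.zero)
    have h2 := hφ (-K) (by simpa [mem_hermitianPartCone, hK] using PosSemidef.zero)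
    rw [map_neg] at h2
    linarith
  rw [Module.Dual.extendRCLike_apply, hanti (RCLike.I (K := ℂ) • X) (by
    rw [conjTranspose_smul, hX.1.eq]; simp)]
  simpa using hφ X (by rw [mem_hermitianPartCone, hX.1.eq]; exact hX.add hX)

/-- Over the complex numbers the Hermitian condition follows from positivity of the form. -/
theorem posSemidef_of_forall_dotProduct_mulVec_nonneg {ι : Type*} [Fintype ι] {A : Matrix ι ι ℂ}
    (h : ∀ v : ι → ℂ, 0 ≤ star v ⬝ᵥ (A *ᵥ v)) : A.PosSemidef := by
  classical
  rw [← isPositive_toEuclideanLin_iff, LinearMap.isPositive_iff_complex]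
  intro x
  have hx := Complex.nonneg_iff.mp (h x.ofLp)
  have key : star (inner ℂ (A.toEuclideanLin x) x) = star x.ofLp ⬝ᵥ (A *ᵥ x.ofLp) := by
    rw [EuclideanSpace.inner_eq_star_dotProduct, dotProduct_star, star_star, dotProduct_comm]
    rfl
  have key2 : inner ℂ (A.toEuclideanLin x) x = star x.ofLp ⬝ᵥ (A *ᵥ x.ofLp) := by
    rw [← star_star (inner ℂ (A.toEuclideanLin x) x), key]
    exact Complex.ext (by simp) (by simp [← hx.2])
  rw [key2]
  exact ⟨Complex.ext rfl hx.2, hx.1⟩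

/-- The linear map `E` for which `Tr[M E(Y)] = Φ(Mᵀ ⊗ Y)`. -/
def mapOfFunctional {a b : ℕ} (Φ : Matrix (Fin a × Fin b) (Fin a × Fin b) ℂ →ₗ[ℂ] ℂ) :
    Matrix (Fin b) (Fin b) ℂ →ₗ[ℂ] Matrix (Fin a) (Fin a) ℂ where
  toFun Y := Matrix.of fun i j => Φ (single i j 1 ⊗ₖ Y)
  map_add' Y Z := by ext i j; simp [kronecker_add]
  map_smul' c Y := by ext i j; simp [kronecker_smul]

theorem trace_mul_mapOfFunctional {a b : ℕ}
    (Φ : Matrix (Fin a × Fin b) (Fin a × Fin b) ℂ →ₗ[ℂ] ℂ) (M : Matrix (Fin a) (Fin a) ℂ)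
    (Y : Matrix (Fin b) (Fin b) ℂ) :
    (M * mapOfFunctional Φ Y).trace = Φ (M.transpose ⊗ₖ Y) := by
  have h : M.transpose ⊗ₖ Y = ∑ i, ∑ j, M j i • (single i j 1 ⊗ₖ Y) := by
    ext ⟨i, p⟩ ⟨j, q⟩
    simp [Matrix.sum_apply, single_apply, ite_and]
  rw [h, Finset.sum_comm]
  simp [trace, mul_apply, mapOfFunctional]

theorem isChannel_mapOfFunctional {a b : ℕ}
    {Φ : Matrix (Fin a × Fin b) (Fin a × Fin b) ℂ →ₗ[ℂ] ℂ}
    (hpos : ∀ X : Matrix (Fin a × Fin b) (Fin a × Fin b) ℂ, X.PosSemidef → 0 ≤ Φ X)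
    (htr : ∀ Y : Matrix (Fin b) (Fin b) ℂ,
      Φ ((1 : Matrix (Fin a) (Fin a) ℂ) ⊗ₖ Y) = Y.trace) :
    IsChannel (mapOfFunctional Φ) := by
  refine ⟨fun k X hX => ?_, fun Y => ?_⟩
  · have hform : ∀ v : Fin k × Fin a → ℂ, 0 ≤ star v ⬝ᵥ ((Matrix.of fun (p q : Fin k × Fin a) =>
        mapOfFunctional Φ (Matrix.of fun a b => X (p.1, a) (q.1, b)) p.2 q.2) *ᵥ v) := by
      intro v
      -- The form at `v` is `Φ` of the compression of `X` by `v`, seen as a map between the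
      -- ancilla and the output space.
      let B : Matrix (Fin k × Fin b) (Fin a × Fin b) ℂ :=
        (Matrix.of fun p i => v (p, i)) ⊗ₖ (1 : Matrix (Fin b) (Fin b) ℂ)
      have hB : Bᴴ * X * B = ∑ p : Fin k × Fin a, ∑ q : Fin k × Fin a, (star (v p) * v q) •
          (single p.2 q.2 1 ⊗ₖ (Matrix.of fun a b => X (p.1, a) (q.1, b))) := by
        ext ⟨i, s⟩ ⟨j, t⟩
        simp only [B, mul_apply, Matrix.sum_apply, Fintype.sum_prod_type, conjTranspose_apply,
          kroneckerMap_apply, of_apply, one_apply, Matrix.smul_apply, smul_eq_mul, single_apply,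
          ite_and]
        simp only [mul_ite, mul_one, mul_zero, ite_mul, one_mul, zero_mul, apply_ite star, star_zero,
          Finset.sum_ite_eq', Finset.mem_univ, if_true, Finset.sum_mul,
          Finset.sum_const_zero, Finset.sum_ite_irrel]
        rw [Finset.sum_comm]
        exact Finset.sum_congr rfl fun p _ => Finset.sum_congr rfl fun q _ => by ring
      have h := hpos _ (hX.conjTranspose_mul_mul_same B)
      rw [hB] at h
      convert h using 1
      simp only [dotProduct, mulVec, Finset.mul_sum, map_sum, map_smul, mapOfFunctional,
        Pi.star_apply, of_apply, LinearMap.coe_mk, AddHom.coe_mk, smul_eq_mul]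
      refine Finset.sum_congr rfl fun p _ => Finset.sum_congr rfl fun q _ => ?_
      ring
    exact posSemidef_of_forall_dotProduct_mulVec_nonneg hform
  · rw [← one_mul (mapOfFunctional Φ Y), trace_mul_mapOfFunctional, transpose_one, htr]

/-! ### Dual sets -/

theorem average_mem_dual {d n : ℕ} (hn : 0 < n) {F : Set (Matrix (Fin d) (Fin d) ℂ)}
    {ω : Fin n → Matrix (Fin d) (Fin d) ℂ} (hω : ∀ l, ω l ∈ dual F) : average ω ∈ dual F := by
  have hn' : (n : ℂ) ≠ 0 := by exact_mod_cast hn.ne'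
  refine ⟨⟨(posSemidef_sum _ fun l _ => (hω l).1.1).smul (inv_nonneg.2 (Nat.cast_nonneg n)), ?_⟩,
    fun σ hσ σ' hσ' => ?_⟩
  · simp [trace_sum, (hω _).1.2, hn', average]
  · simp only [average, smul_mul, Finset.sum_mul, trace_smul, trace_sum]
    rw [Finset.sum_congr rfl fun l _ => (hω l).2 σ hσ σ' hσ']

theorem natCast_mul_overlap_average {d n : ℕ} (hn : 0 < n) {F : Set (Matrix (Fin d) (Fin d) ℂ)}
    {ω : Fin n → Matrix (Fin d) (Fin d) ℂ} (hω : ∀ l, ω l ∈ dual F)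
    {s : Matrix (Fin d) (Fin d) ℂ} (hs : s ∈ F) :
    n * overlap F (average ω) = ∑ l, (ω l * s).trace.re := by
  have hn' : (n : ℝ) ≠ 0 := by exact_mod_cast hn.ne'
  rw [overlap_eq (average_mem_dual hn hω) hs, average, smul_mul, Finset.sum_mul, trace_smul,
    trace_sum, show ((n : ℂ)⁻¹) = ((n : ℝ)⁻¹ : ℝ) by push_cast; rfl, smul_eq_mul,
    Complex.re_ofReal_mul, mul_inv_cancel_left₀ hn', Complex.re_sum]

/-- The real subspace of matrices whose real trace pairing is constant on `F`. If `F` consists of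
density matrices, then the dual set of `F` consists of the density matrices in this subspace. -/
def realDual {d : ℕ} (F : Set (Matrix (Fin d) (Fin d) ℂ)) :
    Submodule ℝ (Matrix (Fin d) (Fin d) ℂ) where
  carrier := {ω | ∀ σ ∈ F, ∀ σ' ∈ F, (ω * σ).trace.re = (ω * σ').trace.re}
  zero_mem' := by simp
  add_mem' {ω ω'} h h' σ hσ σ' hσ' := by
    simp [add_mul, h σ hσ σ' hσ', h' σ hσ σ' hσ']
  smul_mem' c ω h σ hσ σ' hσ' := by
    simp [h σ hσ σ' hσ']

/-- An affine set contains every density matrix that its dual does not distinguish from a member: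
a real functional vanishing on the span of `F` is a trace pairing with an element of
`realDual F`. -/
theorem IsAffine.mem_of_forall_realDual {d : ℕ} {F : Set (Matrix (Fin d) (Fin d) ℂ)}
    (hF : IsAffine F) {s M : Matrix (Fin d) (Fin d) ℂ} (hs : s ∈ F) (hM : M ∈ densityMatrices d)
    (h : ∀ ω ∈ realDual F, (ω * M).trace.re = (ω * s).trace.re) : M ∈ F := by
  have hspan : M ∈ Submodule.span ℝ F := by
    by_contra hMF
    obtain ⟨φ, hφM, hφF⟩ := Submodule.exists_le_ker_of_notMem hMF
    let ω : Matrix (Fin d) (Fin d) ℂ :=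
      Matrix.of fun i j => Module.Dual.extendRCLike (𝕜 := ℂ) φ (single j i 1)
    have hω : ∀ Y : Matrix (Fin d) (Fin d) ℂ, (ω * Y).trace.re = φ Y := by
      intro Y
      have : (ω * Y).trace = Module.Dual.extendRCLike (𝕜 := ℂ) φ Y := by
        have hY : Y = ∑ i, ∑ j, single j i (Y j i) := by
          rw [Finset.sum_comm]
          exact matrix_eq_sum_single Y
        conv_rhs => rw [hY]
        simp only [trace, diag_apply, mul_apply, map_sum]
        refine Finset.sum_congr rfl fun i _ => Finset.sum_congr rfl fun j _ => ?_
        rw [← mul_one (Y j i), ← smul_eq_mul (Y j i) (1 : ℂ), ← smul_single, map_smul]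
        simp [ω, mul_comm]
      rw [this]
      exact Module.Dual.re_extendRCLike_apply (𝕜 := ℂ) φ Y
    have hφ0 : ∀ σ ∈ F, φ σ = 0 := fun σ hσ => hφF (Submodule.subset_span hσ)
    have := h ω fun σ hσ σ' hσ' => by rw [hω, hω, hφ0 σ hσ, hφ0 σ' hσ']
    rw [hω, hω, hφ0 s hs] at this
    exact hφM this
  obtain ⟨k, t, σ, rfl⟩ := Submodule.mem_span_set'.mp hspan
  exact hF.2 k t (fun i => σ i) (fun i => (σ i).2) hM

/-! ### The channel from the extension theorem -/

theorem eq_of_forall_re_eq {V : Type*} [SMul ℂ V] {f g : V → ℂ}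
    (hf : ∀ v, f (Complex.I • v) = Complex.I * f v) (hg : ∀ v, g (Complex.I • v) = Complex.I * g v)
    (h : ∀ v, (f v).re = (g v).re) (v : V) : f v = g v := by
  refine Complex.ext (h v) ?_
  have := h (Complex.I • v)
  rw [hf, hg, Complex.I_mul_re, Complex.I_mul_re] at this
  linarith

/-- If the functional prescribed by "`E` is trace preserving, `E ρ = ρ'`, and `E (σ l)` pairs with
`realDual F` as `s` does" is nonnegative wherever the matching bipartite matrix lies in the cone,
then such a channel `E` exists. -/
theorem exists_isChannel_of_forall {a b n : ℕ} {F : Set (Matrix (Fin a) (Fin a) ℂ)}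
    {s ρ' : Matrix (Fin a) (Fin a) ℂ} {ρ : Matrix (Fin b) (Fin b) ℂ}
    {σ : Fin n → Matrix (Fin b) (Fin b) ℂ}
    (h : ∀ (τ : Matrix (Fin b) (Fin b) ℂ) (η : Matrix (Fin a) (Fin a) ℂ)
      (ω : Fin n → Matrix (Fin a) (Fin a) ℂ), (∀ l, ω l ∈ realDual F) →
      (1 : Matrix (Fin a) (Fin a) ℂ) ⊗ₖ τ + η.transpose ⊗ₖ ρ + ∑ l, (ω l).transpose ⊗ₖ σ l ∈
        hermitianPartCone (Fin a × Fin b) →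
      0 ≤ τ.trace.re + (η * ρ').trace.re + ∑ l, (ω l * s).trace.re) :
    ∃ E : Matrix (Fin b) (Fin b) ℂ →ₗ[ℂ] Matrix (Fin a) (Fin a) ℂ, IsChannel E ∧ E ρ = ρ' ∧
      ∀ ω ∈ realDual F, ∀ l, (ω * E (σ l)).trace.re = (ω * s).trace.re := by
  let A : (Matrix (Fin b) (Fin b) ℂ × Matrix (Fin a) (Fin a) ℂ × (Fin n → realDual F)) →ₗ[ℝ]
      Matrix (Fin a × Fin b) (Fin a × Fin b) ℂ :=
    { toFun := fun y => (1 : Matrix (Fin a) (Fin a) ℂ) ⊗ₖ y.1 + y.2.1.transpose ⊗ₖ ρ +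
        ∑ l, (y.2.2 l : Matrix (Fin a) (Fin a) ℂ).transpose ⊗ₖ σ l
      map_add' := fun y z => by
        simp only [Prod.fst_add, Prod.snd_add, Pi.add_apply, Submodule.coe_add, transpose_add,
          kronecker_add, add_kronecker, Finset.sum_add_distrib]
        abel
      map_smul' := fun c y => by
        simp only [Prod.smul_fst, Prod.smul_snd, Pi.smul_apply, Submodule.coe_smul,
          transpose_smul, kronecker_smul, smul_kronecker, Finset.smul_sum, smul_add,
          RingHom.id_apply] }
  let ψ : (Matrix (Fin b) (Fin b) ℂ × Matrix (Fin a) (Fin a) ℂ × (Fin n → realDual F)) →ₗ[ℝ] ℝ :=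
    { toFun := fun y => y.1.trace.re + (y.2.1 * ρ').trace.re +
        ∑ l, ((y.2.2 l : Matrix (Fin a) (Fin a) ℂ) * s).trace.re
      map_add' := fun y z => by
        simp only [Prod.fst_add, Prod.snd_add, Pi.add_apply, Submodule.coe_add, trace_add, add_mul,
          Complex.add_re, Finset.sum_add_distrib]
        ring
      map_smul' := fun c y => by
        simp only [Prod.smul_fst, Prod.smul_snd, Pi.smul_apply, Submodule.coe_smul, smul_mul,
          trace_smul, Complex.smul_re, ← Finset.smul_sum, ← smul_add, RingHom.id_apply] }
  obtain ⟨φ, hφ, hpos⟩ := exists_nonneg_extension (hermitianPartCone (Fin a × Fin b)) A ψ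
    (fun y hy => h y.1 y.2.1 (fun l => y.2.2 l) (fun l => (y.2.2 l).2) hy) (fun X => by
      obtain ⟨C, hC⟩ := exists_forall_ge_posSemidef_smul_one_sub
        (isHermitian_add_transpose_self X).neg
      refine ⟨(((C / 2 : ℝ) : ℂ) • 1, 0, 0), ?_⟩
      rw [mem_hermitianPartCone]
      convert hC C le_rfl using 1
      simp [A, kronecker_smul, conjTranspose_add, conjTranspose_smul]
      rw [show C • (1 : Matrix (Fin a × Fin b) (Fin a × Fin b) ℂ) =
        ((C : ℂ) / 2) • 1 + ((C : ℂ) / 2) • 1 by rw [← add_smul, add_halves, Complex.coe_smul]]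
      abel)
  let Φ := Module.Dual.extendRCLike (𝕜 := ℂ) φ
  have hre : ∀ X, (Φ X).re = φ X := Module.Dual.re_extendRCLike_apply (𝕜 := ℂ) φ
  have hτ : ∀ τ : Matrix (Fin b) (Fin b) ℂ, Φ ((1 : Matrix (Fin a) (Fin a) ℂ) ⊗ₖ τ) = τ.trace :=
    eq_of_forall_re_eq (fun τ => by rw [kronecker_smul, map_smul, smul_eq_mul])
      (fun τ => by rw [trace_smul, smul_eq_mul])
      (fun τ => by rw [hre]; simpa [A, ψ] using hφ (τ, 0, 0))
  have hη : ∀ η : Matrix (Fin a) (Fin a) ℂ, Φ (η.transpose ⊗ₖ ρ) = (η * ρ').trace :=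
    eq_of_forall_re_eq (fun η => by rw [transpose_smul, smul_kronecker, map_smul, smul_eq_mul])
      (fun η => by rw [smul_mul, trace_smul, smul_eq_mul])
      (fun η => by rw [hre]; simpa [A, ψ] using hφ (0, η, 0))
  refine ⟨mapOfFunctional Φ,
    isChannel_mapOfFunctional (fun X hX => extendRCLike_nonneg hpos hX) hτ, ?_, ?_⟩
  · rw [ext_iff_trace_mul_left]
    intro η
    rw [trace_mul_mapOfFunctional, hη]
  · intro ω hω l
    rw [trace_mul_mapOfFunctional, hre]
    have := hφ (0, 0, Pi.single l ⟨ω, hω⟩)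
    simp only [A, ψ, LinearMap.coe_mk, AddHom.coe_mk] at this
    rw [Finset.sum_eq_single l, Finset.sum_eq_single l] at this
    · simpa using this
    all_goals simp +contextual

/-! ### Normalization -/

theorem trace_conjTranspose_mul_re {ι : Type*} [Fintype ι] (M : Matrix ι ι ℂ)
    {H : Matrix ι ι ℂ} (hH : H.IsHermitian) : (Mᴴ * H).trace.re = (M * H).trace.re := by
  have : (Mᴴ * H).trace = star (M * H).trace := by
    rw [← trace_conjTranspose, conjTranspose_mul, hH.eq, trace_mul_comm]
  rw [this]
  rfl

theorem trace_mul_im_eq_zero {ι : Type*} [Fintype ι] {H K : Matrix ι ι ℂ}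
    (hH : H.IsHermitian) (hK : K.IsHermitian) : (H * K).trace.im = 0 := by
  have : star (H * K).trace = (H * K).trace := by
    rw [← trace_conjTranspose, conjTranspose_mul, hH.eq, hK.eq, trace_mul_comm]
  exact Complex.conj_eq_iff_im.mp this

/-- The matrix `(c I - H) / N` with `c` chosen such that the trace is one when `H` is Hermitian and
`N ≠ 0`. -/
noncomputable def normalizedNeg {a : ℕ} (N : ℝ) (H : Matrix (Fin a) (Fin a) ℂ) :
    Matrix (Fin a) (Fin a) ℂ :=
  ((N⁻¹ : ℝ) : ℂ) • ((((N + H.trace.re) / a : ℝ) : ℂ) • (1 : Matrix (Fin a) (Fin a) ℂ) - H)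

theorem eventually_normalizedNeg_mem {a : ℕ} (ha : 0 < a) {H : Matrix (Fin a) (Fin a) ℂ}
    (hH : H.IsHermitian) : ∀ᶠ N : ℝ in Filter.atTop, normalizedNeg N H ∈ densityMatrices a := by
  obtain ⟨C, hC⟩ := exists_forall_ge_posSemidef_smul_one_sub hH
  have ha' : (0 : ℝ) < a := by exact_mod_cast ha
  filter_upwards [Filter.eventually_ge_atTop (a * C - H.trace.re), Filter.eventually_gt_atTop 0]
    with N hN hN0
  refine ⟨(hC _ ?_).smul ?_, ?_⟩
  · rw [le_div_iff₀ ha']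
    linarith
  · exact_mod_cast inv_nonneg.2 hN0.le
  · have him : H.trace = (H.trace.re : ℂ) :=
      Complex.ext rfl (by simpa using trace_mul_im_eq_zero hH isHermitian_one)
    rw [normalizedNeg, trace_smul, trace_sub, trace_smul, trace_one, him, Fintype.card_fin,
      smul_eq_mul, smul_eq_mul]
    norm_cast
    field_simp
    simp

theorem re_trace_normalizedNeg_mul {a : ℕ} (N : ℝ) (H : Matrix (Fin a) (Fin a) ℂ)
    {σ : Matrix (Fin a) (Fin a) ℂ} (hσ : σ ∈ densityMatrices a) :
    (normalizedNeg N H * σ).trace.re =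
      N⁻¹ * ((N + H.trace.re) / a - (H * σ).trace.re) := by
  rw [normalizedNeg, smul_mul, sub_mul, smul_mul, one_mul, trace_smul, trace_sub, trace_smul,
    hσ.2, smul_eq_mul, smul_eq_mul, mul_one, Complex.re_ofReal_mul, Complex.sub_re,
    Complex.ofReal_re]

theorem mem_dual_of_mem_realDual {a : ℕ} {F : Set (Matrix (Fin a) (Fin a) ℂ)}
    (hF : F ⊆ densityMatrices a) {ω : Matrix (Fin a) (Fin a) ℂ} (hω : ω ∈ densityMatrices a)
    (h : ω ∈ realDual F) : ω ∈ dual F :=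
  ⟨hω, fun σ hσ σ' hσ' => Complex.ext (h σ hσ σ' hσ') (by
    rw [trace_mul_im_eq_zero hω.1.1 (hF hσ).1.1, trace_mul_im_eq_zero hω.1.1 (hF hσ').1.1])⟩

theorem normalizedNeg_mem_realDual {a : ℕ} {F : Set (Matrix (Fin a) (Fin a) ℂ)}
    (hF : F ⊆ densityMatrices a) (N : ℝ) {H : Matrix (Fin a) (Fin a) ℂ} (h : H ∈ realDual F) :
    normalizedNeg N H ∈ realDual F := fun σ hσ σ' hσ' => by
  rw [re_trace_normalizedNeg_mul N H (hF hσ), re_trace_normalizedNeg_mul N H (hF hσ'),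
    h σ hσ σ' hσ']

/-! ### From the entropic inequalities to a free channel -/

/-- The positivity needed for `exists_isChannel_of_forall`, from the entropic inequalities. All
matrices may be replaced by twice their Hermitian parts. For large `N`, replacing `η` and `ω l` by
`(c I - η) / N` and `(c I - ω l) / N` then gives density matrices, and positivity of the bipartite
matrix exhibits a feasible point of the semidefinite program defining `2 ^ (-H_min(A|B))` at the
resulting `Ω`. -/
theorem nonneg_of_forall_le_condMinEntropy {a b n : ℕ} (hn : 0 < n) (ha : 0 < a)
    {F : Set (Matrix (Fin a) (Fin a) ℂ)} (hF : F ⊆ densityMatrices a)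
    {s ρ' : Matrix (Fin a) (Fin a) ℂ} (hs : s ∈ F) (hρ' : ρ' ∈ densityMatrices a)
    {ρ : Matrix (Fin b) (Fin b) ℂ} (hρ : ρ ∈ densityMatrices b)
    {σ : Fin n → Matrix (Fin b) (Fin b) ℂ} (hσ : ∀ l, σ l ∈ densityMatrices b)
    (h : ∀ η ∈ densityMatrices a, ∀ ω : Fin n → Matrix (Fin a) (Fin a) ℂ, (∀ l, ω l ∈ dual F) →
      (2 : ℝ) ^ (-condMinEntropy (Omega n η (Theta ω σ) ρ)) ≥
        ((η * ρ').trace.re + n * overlap F (average ω)) / (n + 1))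
    (τ : Matrix (Fin b) (Fin b) ℂ) (η : Matrix (Fin a) (Fin a) ℂ)
    (ω : Fin n → Matrix (Fin a) (Fin a) ℂ) (hω : ∀ l, ω l ∈ realDual F)
    (hcone : (1 : Matrix (Fin a) (Fin a) ℂ) ⊗ₖ τ + η.transpose ⊗ₖ ρ +
      ∑ l, (ω l).transpose ⊗ₖ σ l ∈ hermitianPartCone (Fin a × Fin b)) :
    0 ≤ τ.trace.re + (η * ρ').trace.re + ∑ l, (ω l * s).trace.re := by
  have hηh : (η + ηᴴ).IsHermitian := isHermitian_add_transpose_self η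
  have hωh : ∀ l, (ω l + (ω l)ᴴ).IsHermitian := fun l => isHermitian_add_transpose_self _
  have hωd : ∀ l, ω l + (ω l)ᴴ ∈ realDual F := fun l => (realDual F).add_mem (hω l)
    fun x hx y hy => by
      rw [trace_conjTranspose_mul_re _ (hF hx).1.1, trace_conjTranspose_mul_re _ (hF hy).1.1]
      exact hω l x hx y hy
  have hZ : ((1 : Matrix (Fin a) (Fin a) ℂ) ⊗ₖ (τ + τᴴ) + (η + ηᴴ).transpose ⊗ₖ ρ +
      ∑ l, (ω l + (ω l)ᴴ).transpose ⊗ₖ σ l).PosSemidef := by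
    rw [mem_hermitianPartCone] at hcone
    have hct : ∀ M : Matrix (Fin a) (Fin a) ℂ, Mᵀᴴ = Mᴴᵀ := fun _ => rfl
    convert hcone using 1
    simp only [conjTranspose_add, conjTranspose_sum, conjTranspose_kronecker, conjTranspose_one,
      kronecker_add, add_kronecker, transpose_add, hρ.1.1.eq, (hσ _).1.1.eq,
      Finset.sum_add_distrib, hct]
    abel
  obtain ⟨N, hN0, hNη, hNω⟩ := ((Filter.eventually_gt_atTop (0 : ℝ)).and
    ((eventually_normalizedNeg_mem ha hηh).and
      (Filter.eventually_all.2 fun l => eventually_normalizedNeg_mem ha (hωh l)))).exists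
  have hdual : ∀ l, normalizedNeg N (ω l + (ω l)ᴴ) ∈ dual F := fun l =>
    mem_dual_of_mem_realDual hF (hNω l) (normalizedNeg_mem_realDual hF N (hωd l))
  have key := h _ hNη _ hdual
  rw [natCast_mul_overlap_average hn hdual hs, re_trace_normalizedNeg_mul N _ hρ',
    Finset.sum_congr rfl fun l _ => re_trace_normalizedNeg_mul N (ω l + (ω l)ᴴ) (hF hs),
    two_rpow_neg_condMinEntropy_Omega_Theta hn hNη hNω hσ hρ, ← Finset.mul_sum, ← mul_add] at key
  set Ω := Omega n (normalizedNeg N (η + ηᴴ)) (Theta (fun l => normalizedNeg N (ω l + (ω l)ᴴ)) σ) ρ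
    with hΩ
  set c : ℝ := (N + (η + ηᴴ).trace.re) / a with hc
  set e : Fin n → ℝ := fun l => (N + (ω l + (ω l)ᴴ).trace.re) / a with he
  have hn1 : (0 : ℝ) < n + 1 := by positivity
  have hr : (0 : ℝ) ≤ (n + 1 : ℝ)⁻¹ * N⁻¹ := by positivity
  let T : Matrix (Fin b) (Fin b) ℂ :=
    (((n + 1 : ℝ)⁻¹ * N⁻¹ : ℝ) : ℂ) • ((c : ℂ) • ρ + ∑ l, (e l : ℂ) • σ l + (τ + τᴴ))
  have hT : ((1 : Matrix (Fin a) (Fin a) ℂ) ⊗ₖ T - Ω).PosSemidef := by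
    convert hZ.smul (α := ℂ) (by exact_mod_cast hr :
      (0 : ℂ) ≤ (((n + 1 : ℝ)⁻¹ * N⁻¹ : ℝ) : ℂ)) using 1
    have hsum : (1 : Matrix (Fin a) (Fin a) ℂ) ⊗ₖ (∑ l, (e l : ℂ) • σ l) =
        ∑ l, (e l : ℂ) • ((1 : Matrix (Fin a) (Fin a) ℂ) ⊗ₖ σ l) := by
      ext p q
      simp [Matrix.sum_apply, Finset.mul_sum, mul_left_comm]
    have hn2 : ((n : ℂ) + 1)⁻¹ = (((n + 1 : ℝ)⁻¹ : ℝ) : ℂ) := by push_cast; rfl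
    have hflip : ∀ (H : Matrix (Fin a) (Fin a) ℂ) (Y : Matrix (Fin b) (Fin b) ℂ),
        (normalizedNeg N H).transpose ⊗ₖ Y = ((N⁻¹ : ℝ) : ℂ) •
          ((((N + H.trace.re) / a : ℝ) : ℂ) • ((1 : Matrix (Fin a) (Fin a) ℂ) ⊗ₖ Y) -
            H.transpose ⊗ₖ Y) := by
      intro H Y
      rw [normalizedNeg, transpose_smul, transpose_sub, transpose_smul, transpose_one,
        smul_kronecker, sub_eq_add_neg, add_kronecker, smul_kronecker, ← neg_one_smul ℂ,
        smul_kronecker, neg_one_smul, sub_eq_add_neg]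
    rw [hΩ, Omega, natCast_smul_Theta hn, hn2, hflip,
      Finset.sum_congr rfl fun l _ => hflip (ω l + (ω l)ᴴ) (σ l), ← Finset.smul_sum, ← smul_add,
      smul_smul, ← Complex.ofReal_mul, kronecker_smul, ← smul_sub, kronecker_add, kronecker_add,
      kronecker_smul, hsum, Finset.sum_sub_distrib]
    congr 1
    abel
  have hTpos : T.PosSemidef := by
    refine posSemidef_of_one_kronecker ha ?_
    have := hT.add (posSemidef_Omega_Theta hNη hNω hσ hρ)
    rwa [← hΩ, sub_add_cancel] at this
  have hle := key.trans (csInf_le (bddBelow_feasibleTraces Ω) ⟨T, hTpos, hT, rfl⟩)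
  have htr : T.trace.re = (n + 1 : ℝ)⁻¹ * (N⁻¹ * (c + ∑ l, e l + 2 * τ.trace.re)) := by
    simp only [T, trace_smul, trace_add, trace_sum, hρ.2, (hσ _).2, smul_eq_mul, mul_one,
      Complex.re_ofReal_mul, Complex.add_re, Complex.re_sum, Complex.ofReal_re,
      trace_conjTranspose]
    rw [mul_assoc, two_mul]
    rfl
  have hη2 : ((η + ηᴴ) * ρ').trace.re = 2 * (η * ρ').trace.re := by
    rw [add_mul, trace_add, Complex.add_re, trace_conjTranspose_mul_re _ hρ'.1.1, two_mul]
  have hω2 : ∀ l, ((ω l + (ω l)ᴴ) * s).trace.re = 2 * (ω l * s).trace.re := fun l => by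
    rw [add_mul, trace_add, Complex.add_re, trace_conjTranspose_mul_re _ (hF hs).1.1, two_mul]
  rw [htr, div_eq_inv_mul, mul_le_mul_iff_right₀ (inv_pos.2 hn1),
    mul_le_mul_iff_right₀ (inv_pos.2 hN0), Finset.sum_sub_distrib, hη2,
    Finset.sum_congr rfl fun l _ => hω2 l, ← Finset.mul_sum] at hle
  linarith

theorem exists_mem_rngOperations_of_forall {a b n : ℕ} (hn : 0 < n)
    {Finp : Set (Matrix (Fin b) (Fin b) ℂ)} {F : Set (Matrix (Fin a) (Fin a) ℂ)}
    (hFinp : Finp ⊆ densityMatrices b) (hF : IsAffine F) (hne : F.Nonempty)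
    {ρ' : Matrix (Fin a) (Fin a) ℂ} (hρ' : ρ' ∈ densityMatrices a)
    {ρ : Matrix (Fin b) (Fin b) ℂ} (hρ : ρ ∈ densityMatrices b)
    {σ : Fin n → Matrix (Fin b) (Fin b) ℂ} (hσ : ∀ l, σ l ∈ Finp)
    (hspan : Submodule.span ℝ (Set.range σ) = Submodule.span ℝ Finp)
    (h : ∀ η ∈ densityMatrices a, ∀ ω : Fin n → Matrix (Fin a) (Fin a) ℂ, (∀ l, ω l ∈ dual F) →
      (2 : ℝ) ^ (-condMinEntropy (Omega n η (Theta ω σ) ρ)) ≥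
        ((η * ρ').trace.re + n * overlap F (average ω)) / (n + 1)) :
    ∃ E ∈ rngOperations Finp F, ρ' = E ρ := by
  obtain ⟨s, hs⟩ := hne
  have ha : 0 < a := by
    rcases Nat.eq_zero_or_pos a with rfl | ha
    · simpa [trace] using hρ'.2
    · exact ha
  have hσ' := fun l => hFinp (hσ l)
  obtain ⟨E, hE, hEρ, hEσ⟩ := exists_isChannel_of_forall
    (nonneg_of_forall_le_condMinEntropy hn ha hF.1 hs hρ' hρ hσ' h)
  have hmem : ∀ l, E (σ l) ∈ F := fun l =>
    hF.mem_of_forall_realDual hs (hE.apply_mem (hσ' l)) fun ω hω => hEσ ω hω l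
  refine ⟨E, ⟨hE, fun x hx => ?_⟩, hEρ.symm⟩
  -- `x` is a real combination of the `σ l`, so `E x` is a real combination of elements of `F`.
  have hxs : x ∈ Submodule.span ℝ (Set.range σ) := hspan ▸ Submodule.subset_span hx
  obtain ⟨t, rfl⟩ := (Submodule.mem_span_range_iff_exists_fun ℝ).mp hxs
  have hEx : E (∑ l, t l • σ l) = ∑ l, t l • E (σ l) := by
    rw [map_sum]
    exact Finset.sum_congr rfl fun l _ => LinearMap.map_smul_of_tower E (t l) (σ l)
  rw [hEx]
  exact hF.2 n t _ hmem (hEx ▸ hE.apply_mem (hFinp hx))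

/-! ### The equivalence -/

theorem bddBelow_two_rpow_image {α : Type*} (S : Set α) (g : α → ℝ) :
    BddBelow ((fun x => (2 : ℝ) ^ g x) '' S) :=
  ⟨0, by rintro _ ⟨x, -, rfl⟩; positivity⟩

end AffineResource

open AffineResource in
theorem theorem1 {d d' : ℕ}
    (Finp : Set (Matrix (Fin d) (Fin d) ℂ)) (Fout : Set (Matrix (Fin d') (Fin d') ℂ))
    (hin : AffineResource.IsAffine Finp) (hout : AffineResource.IsAffine Fout)
    (hin_ne : Finp.Nonempty) (hout_ne : Fout.Nonempty)
    (ρ : Matrix (Fin d) (Fin d) ℂ) (hρ : ρ ∈ AffineResource.densityMatrices d)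
    (ρ' : Matrix (Fin d') (Fin d') ℂ) (hρ' : ρ' ∈ AffineResource.densityMatrices d')
    (n : ℕ) (hn : n = Module.finrank ℝ (Submodule.span ℝ Finp))
    (σ : Fin n → Matrix (Fin d) (Fin d) ℂ) (hσ : ∀ l, σ l ∈ Finp)
    (hspan : Submodule.span ℝ (Set.range σ) = Submodule.span ℝ Finp) :
    List.TFAE [
      ∃ E ∈ AffineResource.rngOperations Finp Fout, ρ' = E ρ,
      ∀ η ∈ AffineResource.densityMatrices d', ∀ ω : Fin n → Matrix (Fin d') (Fin d') ℂ,
        (∀ l, ω l ∈ AffineResource.dual Fout) →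
        (2 : ℝ) ^ (-AffineResource.condMinEntropy
            (AffineResource.Omega n η (AffineResource.Theta ω σ) ρ)) ≥
          ((η * ρ').trace.re + n * AffineResource.overlap Fout (AffineResource.average ω)) / (n + 1),
      ∀ η ∈ AffineResource.densityMatrices d',
        ∀ t ∈ AffineResource.overlap Fout '' AffineResource.dual Fout,
        AffineResource.R Fout Finp n η t ρ ≥ AffineResource.R Fout Fout n η t ρ',
      ∀ η ∈ AffineResource.densityMatrices d', ∀ ω : Fin n → Matrix (Fin d') (Fin d') ℂ,
        (∀ l, ω l ∈ AffineResource.dual Fout) →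
        AffineResource.f Finp η ω ρ ≥ AffineResource.f Fout η ω ρ'] := by
  have hn0 : 0 < n := by
    -- A nonempty set of density matrices spans a nonzero space.
    rcases Nat.eq_zero_or_pos n with rfl | h
    · obtain ⟨x, hx⟩ := hin_ne
      have h0 : x ∈ Submodule.span ℝ (Set.range σ) := hspan ▸ Submodule.subset_span hx
      rw [Set.range_eq_empty, Submodule.span_empty, Submodule.mem_bot] at h0
      have := (hin.1 hx).2
      simp [h0] at this
    · exact h
  obtain ⟨s, hs⟩ := hout_ne
  -- The lower bound at a state built from free output states, common to 3 → 2 and 4 → 2.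
  have hlower : ∀ η ∈ densityMatrices d', ∀ ω : Fin n → Matrix (Fin d') (Fin d') ℂ,
      (∀ l, ω l ∈ dual Fout) → ∀ κ : Fin n → Matrix (Fin d') (Fin d') ℂ, (∀ l, κ l ∈ Fout) →
      ((η * ρ').trace.re + n * overlap Fout (average ω)) / (n + 1) ≤
        (2 : ℝ) ^ (-condMinEntropy (Omega n η (Theta ω κ) ρ')) := by
    intro η hη ω hω κ hκ
    rw [natCast_mul_overlap_average hn0 hω hs,
      Finset.sum_congr rfl fun l _ => by rw [(hω l).2 s hs (κ l) (hκ l)]]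
    exact le_two_rpow_neg_condMinEntropy hn0 hη (fun l => (hω l).1) (fun l => hout.1 (hκ l)) hρ'
  tfae_have 1 → 3 := by
    rintro ⟨E, ⟨hE, hEF⟩, rfl⟩ η hη t ⟨ω₀, hω₀, rfl⟩
    refine le_csInf (Set.Nonempty.image _ ?_) ?_
    · refine ⟨Theta (fun _ => ω₀) σ, fun _ => ω₀, σ, fun _ => hω₀, hσ, ?_, rfl⟩
      rw [average, Finset.sum_const, Finset.card_univ, Fintype.card_fin, ← Nat.cast_smul_eq_nsmul ℂ,
        smul_smul, inv_mul_cancel₀ (by exact_mod_cast hn0.ne'), one_smul]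
    · rintro _ ⟨_, ⟨ω, κ, hω, hκ, ht, rfl⟩, rfl⟩
      have hmem : Theta ω (fun l => E (κ l)) ∈
          thetaSet Fout Fout n (overlap Fout ω₀) :=
        ⟨ω, fun l => E (κ l), hω, fun l => hEF _ (hκ l), ht, rfl⟩
      exact (csInf_le (bddBelow_two_rpow_image _ _) (Set.mem_image_of_mem _ hmem)).trans
        (hE.two_rpow_neg_condMinEntropy_le hn0 hη (fun l => (hω l).1) (fun l => hin.1 (hκ l)) hρ)
  tfae_have 1 → 4 := by
    rintro ⟨E, ⟨hE, hEF⟩, rfl⟩ η hη ω hω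
    refine le_csInf (Set.Nonempty.image _ ⟨σ, hσ⟩) ?_
    rintro _ ⟨κ, hκ, rfl⟩
    have hmem : (fun l => E (κ l)) ∈ {κ' : Fin n → Matrix (Fin d') (Fin d') ℂ | ∀ l, κ' l ∈ Fout} :=
      fun l => hEF _ (hκ l)
    exact (csInf_le (bddBelow_two_rpow_image _ _) (Set.mem_image_of_mem _ hmem)).trans
      (hE.two_rpow_neg_condMinEntropy_le hn0 hη (fun l => (hω l).1) (fun l => hin.1 (hκ l)) hρ)
  tfae_have 3 → 2 := by
    intro h η hη ω hω
    have h1 := h η hη _ ⟨_, average_mem_dual hn0 hω, rfl⟩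
    have hmem : Theta ω σ ∈ thetaSet Fout Finp n (overlap Fout (average ω)) :=
      ⟨ω, σ, hω, hσ, rfl, rfl⟩
    have hne : (thetaSet Fout Fout n (overlap Fout (average ω))).Nonempty :=
      ⟨Theta ω fun _ => s, ω, fun _ => s, hω, fun _ => hs, rfl, rfl⟩
    refine le_trans (le_csInf (hne.image _) ?_) (h1.trans
      (csInf_le (bddBelow_two_rpow_image _ _) (Set.mem_image_of_mem _ hmem)))
    rintro _ ⟨_, ⟨ω', κ, hω', hκ, ht, rfl⟩, rfl⟩
    exact ht ▸ hlower η hη ω' hω' κ hκ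
  tfae_have 4 → 2 := by
    intro h η hη ω hω
    have hmem : σ ∈ {κ : Fin n → Matrix (Fin d) (Fin d) ℂ | ∀ l, κ l ∈ Finp} := hσ
    have hne : {κ : Fin n → Matrix (Fin d') (Fin d') ℂ | ∀ l, κ l ∈ Fout}.Nonempty :=
      ⟨fun _ => s, fun _ => hs⟩
    refine le_trans (le_csInf (hne.image _) ?_) ((h η hη ω hω).trans
      (csInf_le (bddBelow_two_rpow_image _ _) (Set.mem_image_of_mem _ hmem)))
    rintro _ ⟨κ, hκ, rfl⟩
    exact hlower η hη ω hω κ hκ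
  tfae_have 2 → 1 :=
    exists_mem_rngOperations_of_forall hn0 hin.1 hout ⟨s, hs⟩ hρ' hρ hσ hspan
  tfae_finish
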